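/- An \emph{ordered graph} is a finite simple graph together with a linear order on its vertex set; if it has $n$ vertices, its vertex set is identified with $[n]=\{1,\dots,n\}$ through the order. Thus an ordered graph on $[n]$ is a graph with vertex set $[n]$, and two ordered graphs are equal when the order-preserving bijection between their vertex sets is a graph isomorphism. For an ordered graph $G$ and a vertex $v$, let $G-v$ be the ordered graph induced by $G$ on $V(G)\setminus\{v\}$ with the inherited order. The \emph{shadow} of $G$ is $\partial G=\{G-v : v\in V(G)\}$, and the shadow of a collection $\mathcal{G}$ of ordered graphs is $\partial\mathcal{G}=\bigcup_{G\in\mathcal{G}}\partial G$. Theorem. Let $n\in\mathbb{N}$ with $n\geq 136$, and let $\mathcal{G}$ be a collection of ordered graphs on $[n]$. If $|\mathcal{G}|<n$, then $|\partial\mathcal{G}|\geq|\mathcal{G}|$. -/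

import Mathlib

/-- An ordered graph on `n` vertices: its vertex set is identified, through the order, with
`Fin n`, so that it is a simple graph on `Fin n` and isomorphic ordered graphs are equal. -/
abbrev OrderedGraph (n : ℕ) : Type := SimpleGraph (Fin n)

namespace OrderedGraph

/-- The ordered graph `G[U]` induced by `G` on a set `U` of `k` vertices, with the inherited order:
the vertex `i` of `G[U]` is the `i`-th smallest element of `U`. -/
def induced {n k : ℕ} (G : OrderedGraph n) (U : Finset (Fin n)) (hU : U.card = k) :
    OrderedGraph k :=
  SimpleGraph.comap (U.orderEmbOfFin hU) G

/-- The complement of a vertex of `Fin n` has `n - 1` elements. -/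
theorem card_erase_vertex {n : ℕ} (v : Fin n) :
    ((Finset.univ : Finset (Fin n)).erase v).card = n - 1 := by
  simp

/-- The ordered graph `G - v = G[V(G) \ {v}]`. -/
def deleteVertex {n : ℕ} (G : OrderedGraph n) (v : Fin n) : OrderedGraph (n - 1) :=
  induced G ((Finset.univ : Finset (Fin n)).erase v) (card_erase_vertex v)

/-- The shadow `∂G` of an ordered graph: all the ordered graphs `G - v`. -/
def shadow {n : ℕ} (G : OrderedGraph n) : Set (OrderedGraph (n - 1)) :=
  {H | ∃ v : Fin n, H = deleteVertex G v}

/-- The shadow `∂𝒢` of a collection of ordered graphs: the union of the shadows `∂G`, `G ∈ 𝒢`. -/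
def familyShadow {n : ℕ} (𝒢 : Set (OrderedGraph n)) : Set (OrderedGraph (n - 1)) :=
  ⋃ G ∈ 𝒢, shadow G

end OrderedGraph

/-! The claim is strengthened so that it can be proved by induction on the number of vertices: a
family `A` of vertex-coloured graphs on `k + 2` vertices showing `q` colours has a shadow of size at
least `min |A| (k + q)` (`min_card_le_card_familyShadow`). With a single colour this is `min |𝒢| (n
- 1)`, which suffices.

For the induction, strip the last vertex and store its adjacencies as an extra bit in the colours of
the others. This splits `A` into links, one for each colour `c` of the last vertex. If every link is
small, the induction hypothesis gives each link a shadow at least its own size, and putting the last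
vertex back keeps these shadows disjoint. Otherwise one link is large; its part of `A` already meets
the bound for its own colours (`card_familyShadow_lastColorPart`), and each colour missing from that
part costs the rest of `A` a new shadow element (`card_familyShadow_add_card_colors_le`). -/

/-- Vertex-coloured ordered graphs on `n` vertices with colours in `α`, built from the last vertex
downwards: a graph on `n + 1` vertices is the colour of its last vertex together with a graph on the
other `n` vertices, whose colours also record the adjacency to the last vertex. -/
def ColoredGraph : ℕ → Type → Type
  | 0, _ => Unit
  | n + 1, α => α × ColoredGraph n (α × Prop)

namespace ColoredGraph

open Finset Classical

/-- The graph with last vertex of colour `c`, and `x` on the other vertices. -/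
def cons {n : ℕ} {α : Type} (c : α) (x : ColoredGraph n (α × Prop)) : ColoredGraph (n + 1) α :=
  (c, x)

/-- The colour of the last vertex. -/
def head {n : ℕ} {α : Type} (x : ColoredGraph (n + 1) α) : α :=
  Prod.fst x

/-- The graph on the vertices other than the last one. -/
def tail {n : ℕ} {α : Type} (x : ColoredGraph (n + 1) α) : ColoredGraph n (α × Prop) :=
  Prod.snd x

@[simp]
theorem head_cons {n : ℕ} {α : Type} (c : α) (x : ColoredGraph n (α × Prop)) :
    (cons c x).head = c :=
  rfl

@[simp]
theorem tail_cons {n : ℕ} {α : Type} (c : α) (x : ColoredGraph n (α × Prop)) :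
    (cons c x).tail = x :=
  rfl

theorem head_tail_ext {n : ℕ} {α : Type} {x y : ColoredGraph (n + 1) α} (h : x.head = y.head)
    (h' : x.tail = y.tail) : x = y :=
  Prod.ext h h'

theorem cons_right_injective {n : ℕ} {α : Type} (c : α) :
    Function.Injective (cons (n := n) c) := fun _ _ h => congrArg tail h

/-- Recolouring of the vertices along `f`. -/
def map : ∀ (n : ℕ) {α β : Type}, (α → β) → ColoredGraph n α → ColoredGraph n β
  | 0, _, _, _, _ => ()
  | n + 1, _, _, f, x => cons (f x.head) (map n (Prod.map f id) x.tail)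

/-- The multiset of the vertex colours. -/
def colorMultiset : ∀ (n : ℕ) {α : Type}, ColoredGraph n α → Multiset α
  | 0, _, _ => 0
  | n + 1, _, x => x.head ::ₘ (colorMultiset n x.tail).map Prod.fst

/-- The coloured graphs obtained by deleting one vertex. -/
noncomputable def shadow : ∀ (n : ℕ) {α : Type}, ColoredGraph (n + 1) α → Finset (ColoredGraph n α)
  | 0, _, _ => {()}
  | n + 1, _, x => insert (map (n + 1) Prod.fst x.tail) ((shadow n x.tail).image (cons x.head))

/-- The shadow of a family of coloured graphs. -/
noncomputable def familyShadow {n : ℕ} {α : Type} (A : Finset (ColoredGraph (n + 1) α)) :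
    Finset (ColoredGraph n α) :=
  A.biUnion (shadow n)

/-- The set of colours that occur in a family of coloured graphs. -/
noncomputable def colors {n : ℕ} {α : Type} (A : Finset (ColoredGraph n α)) : Finset α :=
  A.biUnion fun x => (colorMultiset n x).toFinset

theorem map_succ (n : ℕ) {α β : Type} (f : α → β) (x : ColoredGraph (n + 1) α) :
    map (n + 1) f x = cons (f x.head) (map n (Prod.map f id) x.tail) :=
  rfl

theorem colorMultiset_succ (n : ℕ) {α : Type} (x : ColoredGraph (n + 1) α) :
    colorMultiset (n + 1) x = x.head ::ₘ (colorMultiset n x.tail).map Prod.fst :=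
  rfl

theorem mem_shadow_zero {α : Type} (x : ColoredGraph 1 α) (y : ColoredGraph 0 α) :
    y ∈ shadow 0 x :=
  mem_singleton_self ()

theorem mem_shadow_succ {n : ℕ} {α : Type} {x : ColoredGraph (n + 2) α}
    {y : ColoredGraph (n + 1) α} :
    y ∈ shadow (n + 1) x ↔
      y = map (n + 1) Prod.fst x.tail ∨ ∃ z ∈ shadow n x.tail, cons x.head z = y := by
  rw [← mem_image, ← mem_insert]
  rfl

theorem mem_colors {n : ℕ} {α : Type} {A : Finset (ColoredGraph n α)} {a : α} :
    a ∈ colors A ↔ ∃ x ∈ A, a ∈ colorMultiset n x := by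
  simp [colors]

theorem familyShadow_mono {n : ℕ} {α : Type} {A B : Finset (ColoredGraph (n + 1) α)}
    (h : A ⊆ B) : familyShadow A ⊆ familyShadow B :=
  biUnion_subset_biUnion_of_subset_left _ h

theorem colorMultiset_map (n : ℕ) {α β : Type} (f : α → β) (x : ColoredGraph n α) :
    colorMultiset n (map n f x) = (colorMultiset n x).map f := by
  induction n generalizing α β with
  | zero => rfl
  | succ n ih =>
    simp only [colorMultiset_succ, map_succ, head_cons, tail_cons, ih, Multiset.map_cons,
      Multiset.map_map]
    rfl

theorem card_colorMultiset (n : ℕ) {α : Type} (x : ColoredGraph n α) :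
    Multiset.card (colorMultiset n x) = n := by
  induction n generalizing α with
  | zero => rfl
  | succ n ih => simp [colorMultiset_succ, ih]

/-- Used with `f = Prod.fst`: deleting the last vertex loses only the adjacency bits, so nothing is
lost when each bit is determined by the colour beside it. -/
theorem map_injOn (n : ℕ) {α β : Type} {f : α → β} {s : Set α} (hf : s.InjOn f)
    {x y : ColoredGraph n α} (hx : ∀ a ∈ colorMultiset n x, a ∈ s)
    (hy : ∀ a ∈ colorMultiset n y, a ∈ s) (h : map n f x = map n f y) : x = y := by
  induction n generalizing α β with
  | zero => rfl
  | succ n ih =>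
    have h₀ : f x.head = f y.head := congrArg head h
    have h₁ : map n (Prod.map f id) x.tail = map n (Prod.map f id) y.tail := congrArg tail h
    simp only [colorMultiset_succ, Multiset.mem_cons, Multiset.mem_map, forall_eq_or_imp] at hx hy
    refine head_tail_ext (hf hx.1 hy.1 h₀) (ih (s := Prod.fst ⁻¹' s) ?_
      (fun a ha => hx.2 _ ⟨a, ha, rfl⟩) (fun a ha => hy.2 _ ⟨a, ha, rfl⟩) h₁)
    rintro ⟨a, p⟩ ha ⟨b, q⟩ hb hab
    simp only [Prod.map_apply, id, Prod.mk.injEq] at hab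
    exact Prod.ext (hf ha hb hab.1) hab.2

theorem shadow_nonempty (n : ℕ) {α : Type} (x : ColoredGraph (n + 1) α) :
    (shadow n x).Nonempty := by
  cases n with
  | zero => exact ⟨(), mem_shadow_zero x _⟩
  | succ n => exact ⟨_, mem_shadow_succ.2 (Or.inl rfl)⟩

theorem colorMultiset_le_of_mem_shadow (n : ℕ) {α : Type} {x : ColoredGraph (n + 1) α}
    {y : ColoredGraph n α} (hy : y ∈ shadow n x) : colorMultiset n y ≤ colorMultiset (n + 1) x := by
  induction n generalizing α with
  | zero => exact Multiset.zero_le _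
  | succ n ih =>
    rw [colorMultiset_succ (n + 1)]
    rcases mem_shadow_succ.1 hy with rfl | ⟨z, hz, rfl⟩
    · rw [colorMultiset_map]
      exact Multiset.le_cons_self _ _
    · exact Multiset.cons_le_cons _ (Multiset.map_le_map (ih hz))

/-- Deletions of vertices of different colours are told apart by the remaining colour multisets. -/
theorem exists_mem_shadow_cons (n : ℕ) {α : Type} {x : ColoredGraph (n + 1) α} {a : α}
    (ha : a ∈ colorMultiset (n + 1) x) :
    ∃ y ∈ shadow n x, a ::ₘ colorMultiset n y = colorMultiset (n + 1) x := by
  induction n generalizing α with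
  | zero =>
    refine ⟨(), mem_shadow_zero x _, ?_⟩
    have ha' : a = x.head := Multiset.mem_singleton.1 ha
    subst ha'
    rfl
  | succ n ih =>
    rw [colorMultiset_succ, Multiset.mem_cons, Multiset.mem_map] at ha
    rw [colorMultiset_succ (n + 1)]
    rcases ha with rfl | ⟨b, hb, rfl⟩
    · exact ⟨_, mem_shadow_succ.2 (Or.inl rfl), by rw [colorMultiset_map]⟩
    · obtain ⟨z, hz, hz'⟩ := ih hb
      refine ⟨_, mem_shadow_succ.2 (Or.inr ⟨z, hz, rfl⟩), ?_⟩
      rw [← hz', Multiset.map_cons, colorMultiset_succ, head_cons, tail_cons, Multiset.cons_swap]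

theorem colors_familyShadow_subset {n : ℕ} {α : Type} (A : Finset (ColoredGraph (n + 1) α)) :
    colors (familyShadow A) ⊆ colors A := by
  intro a ha
  obtain ⟨y, hy, hay⟩ := mem_colors.1 ha
  obtain ⟨x, hx, hyx⟩ := mem_biUnion.1 hy
  exact mem_colors.2 ⟨x, hx, Multiset.mem_of_le (colorMultiset_le_of_mem_shadow n hyx) hay⟩

/-! ### New colours force new shadow elements -/

/-- A graph on at least two vertices with `r` colours outside `Q` has at least `r` distinct
vertex-deleted subgraphs that show a colour outside `Q`. -/
theorem card_sdiff_le_card_filter_shadow (n : ℕ) {α : Type} (x : ColoredGraph (n + 2) α)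
    (Q : Finset α) :
    ((colorMultiset (n + 2) x).toFinset \ Q).card ≤
      ((shadow (n + 1) x).filter fun y => ∃ a ∈ colorMultiset (n + 1) y, a ∉ Q).card := by
  set M := colorMultiset (n + 2) x
  have hex : ∀ a ∈ M, ∃ y ∈ shadow (n + 1) x, a ::ₘ colorMultiset (n + 1) y = M :=
    fun a ha => exists_mem_shadow_cons (n + 1) ha
  have : Nonempty (ColoredGraph (n + 1) α) := (shadow_nonempty _ x).nonempty
  choose! d hd hd' using hex
  have hinj : ∀ a ∈ M, ∀ b ∈ M, d a = d b → a = b := by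
    intro a ha b hb hab
    have h := (hd' a ha).trans (hd' b hb).symm
    rw [hab] at h
    exact (Multiset.cons_inj_left _).1 h
  -- With two or more new colours, deleting one leaves another visible. A single new colour `κ`
  -- could vanish on deletion, so a vertex other than one of colour `κ` is deleted, or a second
  -- vertex of colour `κ`.
  by_cases hR : ∃ κ, M.toFinset \ Q = {κ}
  · obtain ⟨κ, hκ⟩ := hR
    have hκM : κ ∈ M ∧ κ ∉ Q := by
      have : κ ∈ M.toFinset \ Q := by simp [hκ]
      simpa using this
    rw [hκ, card_singleton, Nat.succ_le_iff, card_pos]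
    have hκ1 : κ ::ₘ colorMultiset (n + 1) (d κ) = M := hd' κ hκM.1
    obtain ⟨l, hl⟩ : ∃ l, l ∈ colorMultiset (n + 1) (d κ) := by
      rw [← Multiset.card_pos_iff_exists_mem, card_colorMultiset]
      omega
    have hlM : l ∈ M := by rw [← hκ1]; exact Multiset.mem_cons_of_mem hl
    refine ⟨d l, mem_filter.2 ⟨hd l hlM, κ, ?_, hκM.2⟩⟩
    by_cases hlk : l = κ
    · rw [hlk] at hl ⊢
      exact hl
    · have : κ ∈ l ::ₘ colorMultiset (n + 1) (d l) := by rw [hd' l hlM]; exact hκM.1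
      exact (Multiset.mem_cons.1 this).resolve_left (Ne.symm hlk)
  · refine card_le_card_of_injOn d ?_ ?_
    · intro a ha
      have ha' : a ∈ M.toFinset \ Q := ha
      obtain ⟨b, hb, hba⟩ : ∃ b ∈ M.toFinset \ Q, b ≠ a := by
        by_contra! hcon
        exact hR ⟨a, eq_singleton_iff_unique_mem.2 ⟨ha', hcon⟩⟩
      simp only [mem_sdiff, Multiset.mem_toFinset] at ha' hb
      refine mem_filter.2 ⟨hd a ha'.1, b, ?_, hb.2⟩
      have : b ∈ a ::ₘ colorMultiset (n + 1) (d a) := by rw [hd' a ha'.1]; exact hb.1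
      exact (Multiset.mem_cons.1 this).resolve_left hba
    · intro a ha b hb hab
      have ha' : a ∈ M.toFinset \ Q := ha
      have hb' : b ∈ M.toFinset \ Q := hb
      simp only [mem_sdiff, Multiset.mem_toFinset] at ha' hb'
      exact hinj a ha'.1 b hb'.1 hab

/-- Every new colour of a larger family contributes a new element of the shadow. -/
theorem card_familyShadow_add_card_colors_le (n : ℕ) {α : Type}
    {A B : Finset (ColoredGraph (n + 2) α)} (h : B ⊆ A) :
    (familyShadow B).card + (colors A).card ≤ (familyShadow A).card + (colors B).card := by
  suffices H : ∀ C : Finset (ColoredGraph (n + 2) α),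
      (familyShadow B).card + (colors (B ∪ C)).card ≤
        (familyShadow (B ∪ C)).card + (colors B).card by
    have := H A
    rwa [union_eq_right.2 h] at this
  intro C
  induction C using Finset.induction_on with
  | empty => simp
  | insert x C _ ih =>
    set D := B ∪ C
    have hins : B ∪ insert x C = insert x D := by rw [union_insert]
    rw [hins]
    have hcol : (colors (insert x D)).card ≤
        (colors D).card + ((colorMultiset (n + 2) x).toFinset \ colors D).card := by
      have : colors (insert x D) = colors D ∪ ((colorMultiset (n + 2) x).toFinset \ colors D) := by
        rw [union_sdiff_self_eq_union, union_comm]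
        simp [colors, biUnion_insert]
      rw [this]
      exact card_union_le _ _
    have hnew := card_sdiff_le_card_filter_shadow n x (colors D)
    have hsh : (familyShadow D).card + ((shadow (n + 1) x).filter
        fun y => ∃ a ∈ colorMultiset (n + 1) y, a ∉ colors D).card ≤
        (familyShadow (insert x D)).card := by
      rw [← card_union_of_disjoint]
      · refine card_le_card (union_subset (familyShadow_mono (subset_insert _ _)) ?_)
        intro y hy
        exact mem_biUnion.2 ⟨x, mem_insert_self _ _, (mem_filter.1 hy).1⟩
      · rw [disjoint_left]
        intro y hy hy'
        obtain ⟨_, a, ha, haD⟩ := mem_filter.1 hy'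
        exact haD (colors_familyShadow_subset D (mem_colors.2 ⟨y, hy, ha⟩))
    omega

/-! ### Decomposition by the colour of the last vertex -/

/-- The members of `A` whose last vertex has colour `c`. -/
noncomputable def lastColorPart {n : ℕ} {α : Type} (A : Finset (ColoredGraph (n + 1) α)) (c : α) :
    Finset (ColoredGraph (n + 1) α) :=
  A.filter fun x => x.head = c

/-- The members of `A` whose last vertex has colour `c`, without that vertex. -/
noncomputable def link {n : ℕ} {α : Type} (A : Finset (ColoredGraph (n + 1) α)) (c : α) :
    Finset (ColoredGraph n (α × Prop)) :=
  (lastColorPart A c).image tail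

theorem mem_link {n : ℕ} {α : Type} {A : Finset (ColoredGraph (n + 1) α)} {c : α}
    {y : ColoredGraph n (α × Prop)} : y ∈ link A c ↔ cons c y ∈ A := by
  simp only [link, lastColorPart, mem_image, mem_filter]
  constructor
  · rintro ⟨x, ⟨hx, rfl⟩, rfl⟩
    exact hx
  · exact fun h => ⟨cons c y, ⟨h, rfl⟩, rfl⟩

theorem card_link {n : ℕ} {α : Type} (A : Finset (ColoredGraph (n + 1) α)) (c : α) :
    (link A c).card = (lastColorPart A c).card := by
  refine card_image_of_injOn ?_
  intro x hx y hy hxy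
  exact head_tail_ext ((mem_filter.1 hx).2.trans (mem_filter.1 hy).2.symm) hxy

theorem image_cons_familyShadow_link_subset {n : ℕ} {α : Type}
    (A : Finset (ColoredGraph (n + 2) α)) (c : α) :
    (familyShadow (link A c)).image (cons c) ⊆
      (familyShadow (lastColorPart A c)).filter fun y => y.head = c := by
  intro y hy
  obtain ⟨z, hz, rfl⟩ := mem_image.1 hy
  obtain ⟨w, hw, hzw⟩ := mem_biUnion.1 hz
  refine mem_filter.2 ⟨mem_biUnion.2 ⟨cons c w, mem_filter.2 ⟨mem_link.1 hw, rfl⟩, ?_⟩, rfl⟩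
  exact mem_shadow_succ.2 (Or.inr ⟨z, hzw, rfl⟩)

theorem image_map_link_subset {n : ℕ} {α : Type} (A : Finset (ColoredGraph (n + 2) α)) (c : α) :
    (link A c).image (map (n + 1) Prod.fst) ⊆ familyShadow (lastColorPart A c) := by
  intro y hy
  obtain ⟨w, hw, rfl⟩ := mem_image.1 hy
  exact mem_biUnion.2 ⟨cons c w, mem_filter.2 ⟨mem_link.1 hw, rfl⟩,
    mem_shadow_succ.2 (Or.inl rfl)⟩

theorem colors_lastColorPart_subset {n : ℕ} {α : Type} (A : Finset (ColoredGraph (n + 1) α))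
    (c : α) : colors (lastColorPart A c) ⊆ insert c ((colors (link A c)).image Prod.fst) := by
  intro a ha
  obtain ⟨x, hx, hax⟩ := mem_colors.1 ha
  obtain ⟨hxA, rfl⟩ := mem_filter.1 hx
  rw [colorMultiset_succ, Multiset.mem_cons, Multiset.mem_map] at hax
  rcases hax with rfl | ⟨b, hb, rfl⟩
  · exact mem_insert_self _ _
  · exact mem_insert_of_mem (mem_image_of_mem _ (mem_colors.2 ⟨x.tail, mem_link.2 hxA, hb⟩))

theorem fst_mem_of_mem_image_map_link {n : ℕ} {α : Type} {A : Finset (ColoredGraph (n + 2) α)}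
    {c : α} {y : ColoredGraph (n + 1) α} (hy : y ∈ (link A c).image (map (n + 1) Prod.fst)) :
    y.head ∈ (colors (link A c)).image Prod.fst := by
  obtain ⟨w, hw, rfl⟩ := mem_image.1 hy
  exact mem_image_of_mem _ (mem_colors.2 ⟨w, hw, Multiset.mem_cons_self _ _⟩)

/-- If the colour `c` of the last vertex occurs nowhere else, then deleting the last vertex and
deleting another vertex give different graphs. -/
theorem card_image_map_link_add_le {n : ℕ} {α : Type} (A : Finset (ColoredGraph (n + 2) α))
    {c : α} (hc : c ∉ (colors (link A c)).image Prod.fst) :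
    ((link A c).image (map (n + 1) Prod.fst)).card + (familyShadow (link A c)).card ≤
      (familyShadow (lastColorPart A c)).card := by
  rw [← card_image_of_injective (familyShadow (link A c)) (cons_right_injective c),
    ← card_union_of_disjoint]
  · exact card_le_card (union_subset (image_map_link_subset A c)
      ((image_cons_familyShadow_link_subset A c).trans (filter_subset _ _)))
  · rw [disjoint_left]
    intro y hy hy'
    have h := fst_mem_of_mem_image_map_link hy
    obtain ⟨z, _, rfl⟩ := mem_image.1 hy'
    exact hc h

/-- Putting back a last vertex of colour `c` makes the contributions of distinct `c` disjoint. -/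
theorem sum_card_familyShadow_link_le {n : ℕ} {α : Type} (A : Finset (ColoredGraph (n + 2) α))
    (s : Finset α) : ∑ c ∈ s, (familyShadow (link A c)).card ≤ (familyShadow A).card := by
  calc ∑ c ∈ s, (familyShadow (link A c)).card
      ≤ ∑ c ∈ s, ((familyShadow A).filter fun y => y.head = c).card := by
        refine sum_le_sum fun c _ => ?_
        rw [← card_image_of_injective (familyShadow (link A c)) (cons_right_injective c)]
        exact card_le_card ((image_cons_familyShadow_link_subset A c).trans
          (filter_subset_filter _ (familyShadow_mono (filter_subset _ _))))
    _ = (s.biUnion fun c => (familyShadow A).filter fun y => y.head = c).card := by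
        rw [card_biUnion]
        intro c _ d _ hcd
        refine disjoint_left.2 fun y hy hy' => ?_
        exact hcd ((mem_filter.1 hy).2.symm.trans (mem_filter.1 hy').2)
    _ ≤ (familyShadow A).card :=
        card_le_card (biUnion_subset.2 fun c _ => filter_subset _ _)

/-- The bound must gain one over that of the link. If two colours of the link differ only in their
bit, dropping the bits lowers the colour count. If not, deleting the last vertex is injective and
the link, being large, supplies enough shadow elements by itself. -/
theorem card_familyShadow_lastColorPart {k : ℕ} {α : Type}
    (A : Finset (ColoredGraph (k + 1 + 2) α))
    {c : α} (ih : k + (colors (link A c)).card ≤ (familyShadow (link A c)).card)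
    (hc : k + (colors (link A c)).card < (link A c).card) :
    k + 1 + (colors (lastColorPart A c)).card ≤ (familyShadow (lastColorPart A c)).card := by
  have hcol := card_le_card (colors_lastColorPart_subset A c)
  have hle : ((colors (link A c)).image Prod.fst).card ≤ (colors (link A c)).card := card_image_le
  have hne : (link A c).Nonempty := card_pos.1 (by omega)
  have hdel := card_le_card (image_map_link_subset A c)
  have hsh : (familyShadow (link A c)).card ≤ (familyShadow (lastColorPart A c)).card := by
    rw [← card_image_of_injective (familyShadow (link A c)) (cons_right_injective c)]
    exact card_le_card ((image_cons_familyShadow_link_subset A c).trans (filter_subset _ _))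
  have himg : ((colors (link A c)).image Prod.fst).card = (colors (link A c)).card →
      ((link A c).image (map (k + 1 + 1) Prod.fst)).card = (link A c).card := by
    intro h
    refine card_image_of_injOn ?_
    intro x hx y hy hxy
    exact map_injOn _ (card_image_iff.1 h) (fun a ha => mem_colors.2 ⟨x, hx, ha⟩)
      (fun a ha => mem_colors.2 ⟨y, hy, ha⟩) hxy
  have hpos : 0 < ((link A c).image (map (k + 1 + 1) Prod.fst)).card := card_pos.2 (hne.image _)
  have hpos' : 0 < (familyShadow (link A c)).card := by
    obtain ⟨x, hx⟩ := hne
    obtain ⟨y, hy⟩ := shadow_nonempty _ x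
    exact card_pos.2 ⟨y, mem_biUnion.2 ⟨x, hx, hy⟩⟩
  -- A colour `c` found only on the last vertex raises the count by one; this is paid for because
  -- the two kinds of deletion then give disjoint, nonempty sets.
  by_cases hmem : c ∈ (colors (link A c)).image Prod.fst
  · rw [insert_eq_of_mem hmem] at hcol
    by_cases heq : ((colors (link A c)).image Prod.fst).card = (colors (link A c)).card
    · have := himg heq
      omega
    · omega
  · rw [card_insert_of_notMem hmem] at hcol
    have hadd := card_image_map_link_add_le A hmem
    by_cases heq : ((colors (link A c)).image Prod.fst).card = (colors (link A c)).card
    · have := himg heq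
      omega
    · omega

/-- A family of coloured graphs on `k + 2` vertices that shows `q` colours has a shadow that is at
least as large as the family or has at least `k + q` elements. -/
theorem min_card_le_card_familyShadow (k : ℕ) {α : Type} (A : Finset (ColoredGraph (k + 2) α)) :
    min A.card (k + (colors A).card) ≤ (familyShadow A).card := by
  induction k generalizing α with
  | zero =>
    -- On two vertices, comparison with the empty family gives at least `q` shadow elements.
    have h := card_familyShadow_add_card_colors_le 0 (empty_subset A)
    simp only [colors, familyShadow, biUnion_empty, card_empty] at h ⊢
    omega
  | succ k ih =>
    by_cases hgood : ∀ c ∈ A.image head, (link A c).card ≤ k + (colors (link A c)).card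
    · refine (min_le_left _ _).trans ?_
      calc A.card = ∑ c ∈ A.image head, (lastColorPart A c).card :=
            card_eq_sum_card_image head A
        _ ≤ ∑ c ∈ A.image head, (familyShadow (link A c)).card := by
            refine sum_le_sum fun c hc => ?_
            have := ih (link A c)
            rwa [min_eq_left (hgood c hc), card_link] at this
        _ ≤ (familyShadow A).card := sum_card_familyShadow_link_le A _
    · push Not at hgood
      obtain ⟨c, _, hc⟩ := hgood
      have h₁ := ih (link A c)
      rw [min_eq_right hc.le] at h₁
      have h₂ := card_familyShadow_lastColorPart A h₁ hc
      have h₃ : (familyShadow (lastColorPart A c)).card + (colors A).card ≤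
          (familyShadow A).card + (colors (lastColorPart A c)).card :=
        card_familyShadow_add_card_colors_le (k + 1) (filter_subset _ _)
      -- The colours of `A` absent from the part of `c` make up the difference between `h₂` and the
      -- bound for `A`.
      omega

/-! ### Translation from ordered graphs -/

/-- The coloured graph with vertex colours `col` and edges `G`. -/
def encode : ∀ (n : ℕ) {α : Type}, (Fin n → α) → SimpleGraph (Fin n) → ColoredGraph n α
  | 0, _, _, _ => ()
  | n + 1, _, col, G => cons (col (Fin.last n))
      (encode n (fun i => (col i.castSucc, G.Adj i.castSucc (Fin.last n))) (G.comap Fin.castSucc))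

theorem encode_succ (n : ℕ) {α : Type} (col : Fin (n + 1) → α) (G : SimpleGraph (Fin (n + 1))) :
    encode (n + 1) col G = cons (col (Fin.last n))
      (encode n (fun i => (col i.castSucc, G.Adj i.castSucc (Fin.last n)))
        (G.comap Fin.castSucc)) :=
  rfl

theorem encode_injective (n : ℕ) {α : Type} {col col' : Fin n → α} {G G' : SimpleGraph (Fin n)}
    (h : encode n col G = encode n col' G') : col = col' ∧ G = G' := by
  induction n generalizing α with
  | zero => exact ⟨Subsingleton.elim _ _, Subsingleton.elim _ _⟩
  | succ n ih =>
    have h₀ : col (Fin.last n) = col' (Fin.last n) := congrArg head h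
    obtain ⟨hcol, hG⟩ := ih (congrArg tail h)
    have hcol' : ∀ i : Fin n, col i.castSucc = col' i.castSucc := fun i =>
      congrArg Prod.fst (congrFun hcol i)
    have hlast : ∀ i : Fin n, G.Adj i.castSucc (Fin.last n) ↔ G'.Adj i.castSucc (Fin.last n) :=
      fun i => iff_of_eq (congrArg Prod.snd (congrFun hcol i))
    have hrest : ∀ i j : Fin n, G.Adj i.castSucc j.castSucc ↔ G'.Adj i.castSucc j.castSucc := by
      intro i j
      have := congrArg (fun K : SimpleGraph (Fin n) => K.Adj i j) hG
      exact iff_of_eq this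
    refine ⟨funext fun i => ?_, ?_⟩
    · induction i using Fin.lastCases with
      | last => exact h₀
      | cast i => exact hcol' i
    · ext i j
      induction i using Fin.lastCases with
      | last =>
        induction j using Fin.lastCases with
        | last => simp
        | cast j => rw [G.adj_comm, G'.adj_comm]; exact hlast j
      | cast i =>
        induction j using Fin.lastCases with
        | last => exact hlast i
        | cast j => exact hrest i j

theorem map_encode (n : ℕ) {α β : Type} (f : α → β) (col : Fin n → α) (G : SimpleGraph (Fin n)) :
    map n f (encode n col G) = encode n (f ∘ col) G := by
  induction n generalizing α β with
  | zero => rfl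
  | succ n ih => rw [encode_succ, map_succ, tail_cons, ih]; rfl

/-- Only this inclusion is needed: every recursive shadow element is a genuine vertex deletion, so a
lower bound for the recursive shadow transfers. -/
theorem exists_of_mem_shadow_encode (n : ℕ) {α : Type} {col : Fin (n + 1) → α}
    {G : SimpleGraph (Fin (n + 1))} {y : ColoredGraph n α}
    (hy : y ∈ shadow n (encode (n + 1) col G)) :
    ∃ v : Fin (n + 1), y = encode n (col ∘ v.succAbove) (G.comap v.succAbove) := by
  induction n generalizing α with
  | zero => exact ⟨0, rfl⟩
  | succ n ih =>
    rw [encode_succ, mem_shadow_succ, head_cons, tail_cons] at hy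
    rcases hy with rfl | ⟨z, hz, rfl⟩
    · refine ⟨Fin.last _, ?_⟩
      rw [map_encode, Fin.succAbove_last]
      rfl
    · obtain ⟨v, rfl⟩ := ih hz
      refine ⟨v.castSucc, ?_⟩
      have hcomap : (G.comap Fin.castSucc).comap v.succAbove =
          (G.comap v.castSucc.succAbove).comap Fin.castSucc := by
        ext i j
        simp
      have hcol : ((fun i : Fin (n + 1) => (col i.castSucc, G.Adj i.castSucc (Fin.last (n + 1)))) ∘
          v.succAbove) = fun i : Fin n => ((col ∘ v.castSucc.succAbove) i.castSucc,
            (G.comap v.castSucc.succAbove).Adj i.castSucc (Fin.last n)) := by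
        funext i
        simp
      rw [hcomap, hcol]
      rw [encode_succ, Function.comp_apply,
        Fin.succAbove_ne_last_last v.castSucc_lt_last.ne]

end ColoredGraph

theorem OrderedGraph.deleteVertex_eq_comap {n : ℕ} (G : OrderedGraph (n + 1)) (v : Fin (n + 1)) :
    G.deleteVertex v = SimpleGraph.comap v.succAbove G := by
  have h : v.succAboveOrderEmb =
      ((Finset.univ : Finset (Fin (n + 1))).erase v).orderEmbOfFin (card_erase_vertex v) :=
    Finset.orderEmbOfFin_unique' _ fun i => by simp [Fin.succAbove_ne]
  unfold OrderedGraph.deleteVertex OrderedGraph.induced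
  rw [← h]
  rfl

open Classical in
theorem OrderedGraph.min_ncard_le_ncard_familyShadow (k : ℕ) (𝒢 : Set (OrderedGraph (k + 2))) :
    min 𝒢.ncard (k + 1) ≤ (familyShadow 𝒢).ncard := by
  let e : ∀ n, OrderedGraph n → ColoredGraph n Unit :=
    fun n G => ColoredGraph.encode n (fun _ => ()) G
  have he : ∀ n, Function.Injective (e n) := fun n G G' h => (ColoredGraph.encode_injective n h).2
  rcases 𝒢.eq_empty_or_nonempty with rfl | ⟨G₀, hG₀⟩
  · simp
  set A : Finset (ColoredGraph (k + 2) Unit) := 𝒢.toFinset.image (e (k + 2)) with hA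
  have hAcard : A.card = 𝒢.ncard := by
    rw [hA, Finset.card_image_of_injective _ (he _), Set.ncard_eq_toFinset_card']
  -- The constant colouring shows its one colour, which turns `k + q` into `k + 1`.
  have hq : 1 ≤ (ColoredGraph.colors A).card := by
    refine Finset.card_pos.2 ⟨(), ColoredGraph.mem_colors.2 ⟨e _ G₀, ?_, ?_⟩⟩
    · exact Finset.mem_image_of_mem _ (by simpa using hG₀)
    · exact Multiset.mem_cons_self _ _
  have hsub : ColoredGraph.familyShadow A ⊆ (familyShadow 𝒢).toFinset.image (e (k + 1)) := by
    intro y hy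
    obtain ⟨x, hx, hyx⟩ := Finset.mem_biUnion.1 hy
    obtain ⟨G, hG, rfl⟩ := Finset.mem_image.1 hx
    obtain ⟨v, rfl⟩ := ColoredGraph.exists_of_mem_shadow_encode _ hyx
    refine Finset.mem_image.2 ⟨deleteVertex G v, ?_, ?_⟩
    · rw [Set.mem_toFinset]
      exact Set.mem_biUnion (Set.mem_toFinset.1 hG) ⟨v, rfl⟩
    · rw [deleteVertex_eq_comap]
  have hle := Finset.card_le_card hsub
  rw [Finset.card_image_of_injective _ (he _), ← Set.ncard_eq_toFinset_card'] at hle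
  have hmain := ColoredGraph.min_card_le_card_familyShadow k A
  rw [hAcard] at hmain
  omega

theorem theorem1 (n : ℕ) (hn : 136 ≤ n) (𝒢 : Set (OrderedGraph n)) (h𝒢 : 𝒢.ncard < n) :
    𝒢.ncard ≤ (OrderedGraph.familyShadow 𝒢).ncard := by
  obtain ⟨k, rfl⟩ : ∃ k, n = k + 2 := ⟨n - 2, by omega⟩
  have h := OrderedGraph.min_ncard_le_ncard_familyShadow k 𝒢
  rwa [min_eq_left (by omega)] at h
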